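/- **Setting.** Write $I=[0,1]$, $\mathbb N=\{1,2,\dots\}$, and let $\overline B^\infty_r(c)$ be the closed ball (a cube) of radius $r>0$ around $c$ in $\mathbb R^3$ with the sup metric. For a cube $C=\overline B^\infty_r(c)$ let $a_C(x)=2r\,(x-(\tfrac12,\tfrac12,\tfrac12))+c$ be the natural affine map of $I^3$ onto $C$. A continuum is a non-empty compact connected metrizable space. Let $E_0,E_1,E_2,\dots\subseteq[\tfrac14,\tfrac34]^2\times\{\tfrac12\}$ be continua, each with more than one point, which are pairwise non-homeomorphic, and for every $n\ge 0$ let $(d_{n,k})_{k\in\mathbb N}$ be an enumeration of a dense subset of $E_n$. For $n\ge 0$ and $k\in\mathbb N$ put $$F^n_k=\overline B^\infty_{2^{-2k-1}}\bigl(d_{n,k}+(0,0,2^{-2k})\bigr),\qquad C_n=E_n\cup\bigcup_{k\in\mathbb N}F^n_k .$$ Define cubes $F_f$ for finite words $f\in\bigcup_{n\ge0}\mathbb N^n$, and sets $X_n\subseteq I^3$, recursively. Put $F_\emptyset=X_0=I^3$, and for $n\ge 0$, $f\in\mathbb N^n$ and $k\in\mathbb N$ put $$F_{f^\frown k}=a_{F_f}(F^n_k),\qquad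 X_{n+1}=\Bigl(X_n\setminus\bigcup_{f\in\mathbb N^n}F_f\Bigr)\cup\bigcup_{f\in\mathbb N^n}a_{F_f}(C_n).$$ Let $X=\bigcap_{n}X_n$. **Definitions.** The deck of a space $Y$ is the set of homeomorphism classes of the spaces $Y\setminus\{y\}$, $y\in Y$. A space $Y$ is reconstructible if every space with the same deck as $Y$ is homeomorphic to $Y$. A space $Y$ has a constant universal sequence if there is a space $T$ such that for every $y\in Y$ there are pairwise disjoint non-empty clopen sets $B_1,B_2,\dots\subseteq Y$, each homeomorphic to $T$, such that every neighbourhood of $y$ contains all but finitely many of the $B_n$. **Theorem.** The space $X$ is compact and metrizable, it is not reconstructible, and it does not have a constant universal sequence. -/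

import Mathlib

open Set Topology

/-! ### Topological reconstruction -/

/-- Two spaces have the same deck: the sets of homeomorphism classes `{[X \ {x}] : x ∈ X}` and
`{[Z \ {z}] : z ∈ Z}` are equal. -/
def SameDeck (X Z : Type*) [TopologicalSpace X] [TopologicalSpace Z] : Prop :=
  (∀ x : X, ∃ z : Z, Nonempty (({x}ᶜ : Set X) ≃ₜ ({z}ᶜ : Set Z))) ∧
    (∀ z : Z, ∃ x : X, Nonempty (({x}ᶜ : Set X) ≃ₜ ({z}ᶜ : Set Z)))

/-- `X` is reconstructible if every space with the same deck is homeomorphic to `X`. A space with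
the same deck as `X` has the cardinality of `X`, so restricting `Z` to the universe of `X` loses
nothing. -/
def IsReconstructible.{u} (X : Type u) [TopologicalSpace X] : Prop :=
  ∀ (Z : Type u) [TopologicalSpace Z], SameDeck X Z → Nonempty (Z ≃ₜ X)

/-! ### Universal sequences -/

/-- A sequence of subsets of `X` converges to the point `x`: every neighbourhood of `x` contains
all but finitely many of the sets. -/
def SetsConvergeTo {X : Type*} [TopologicalSpace X] (B : ℕ → Set X) (x : X) : Prop :=
  ∀ U ∈ 𝓝 x, ∃ N, ∀ n ≥ N, B n ⊆ U

/-- `X` has a universal sequence of type `T 0, T 1, T 2, …`: every point of `X` is the limit of a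
sequence of pairwise disjoint nonempty clopen sets, the `n`-th of which is homeomorphic to `T n`.
(If empty sets were allowed, every space would trivially have a universal sequence.) -/
def HasUniversalSequenceOfType.{u} (X : Type u) [TopologicalSpace X]
    (T : ℕ → Type u) [∀ n, TopologicalSpace (T n)] : Prop :=
  ∀ x : X, ∃ B : ℕ → Set X,
    (∀ n, (B n).Nonempty) ∧ (∀ n, IsClopen (B n)) ∧ (∀ m n, m ≠ n → Disjoint (B m) (B n)) ∧
      SetsConvergeTo B x ∧ (∀ n, Nonempty (B n ≃ₜ T n))

/-- `X` has a constant universal sequence: one of type `T, T, T, …` for a single space `T`. -/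
def HasConstantUniversalSequence.{u} (X : Type u) [TopologicalSpace X] : Prop :=
  ∃ (T : Type u) (_ : TopologicalSpace T), HasUniversalSequenceOfType X (fun _ : ℕ => T)

/-! ### Cubes in `ℝ³` and relativization -/

/-- `ℝ³`, with the sup metric `d_∞` that Mathlib puts on function spaces. -/
abbrev Space3 : Type := Fin 3 → ℝ

/-- A closed cube of side length `2 * radius > 0`, given by its centre and radius. -/
structure Cube where
  center : Space3
  radius : ℝ
  radius_pos : 0 < radius

namespace Cube

/-- The closed cube as a set: a closed ball for the sup metric. -/
def toSet (C : Cube) : Set Space3 := Metric.closedBall C.center C.radius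

/-- The unit cube `[0,1]³`. -/
noncomputable def unit : Cube where
  center := fun _ => 1 / 2
  radius := 1 / 2
  radius_pos := by norm_num

/-- The natural affine map of `[0,1]³` onto the cube `C` with centre `c` and radius `r`, that is
`x ↦ 2 r (x - (1/2, 1/2, 1/2)) + c`. -/
noncomputable def affineMap (C : Cube) (x : Space3) : Space3 :=
  (2 * C.radius) • (x - fun _ => (1 / 2 : ℝ)) + C.center

/-- The relativization of a set `A` to the cube `C`. -/
def relativize (C : Cube) (A : Set Space3) : Set Space3 := C.affineMap '' A

/-- The relativization of a cube `Q` to the cube `C`, again as a cube. -/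
noncomputable def relCube (C Q : Cube) : Cube where
  center := C.affineMap Q.center
  radius := 2 * C.radius * Q.radius
  radius_pos := mul_pos (mul_pos two_pos C.radius_pos) Q.radius_pos

theorem toSet_unit : unit.toSet = Set.Icc (0 : Space3) 1 := by
  have h : (0 : ℝ) ≤ unit.radius := unit.radius_pos.le
  rw [toSet, closedBall_pi _ h, ← Set.pi_univ_Icc]
  congr 1
  funext i
  rw [Real.closedBall_eq_Icc]
  norm_num [unit]

theorem toSet_relCube (C Q : Cube) : (C.relCube Q).toSet = C.relativize Q.toSet := by
  have hr : 0 < 2 * C.radius := mul_pos two_pos C.radius_pos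
  have key : ∀ x y : Space3,
      dist (C.affineMap x) (C.affineMap y) = 2 * C.radius * dist x y := by
    intro x y
    rw [affineMap, affineMap, dist_add_right, dist_smul₀, dist_sub_right, Real.norm_of_nonneg hr.le]
  ext y
  constructor
  · intro hy
    have hxy : C.affineMap ((2 * C.radius)⁻¹ • (y - C.center) + fun _ => (1 / 2 : ℝ)) = y := by
      simp only [affineMap, add_sub_cancel_right, smul_inv_smul₀ hr.ne', sub_add_cancel]
    refine ⟨_, ?_, hxy⟩
    have h : dist y (C.affineMap Q.center) ≤ 2 * C.radius * Q.radius := hy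
    rw [← hxy, key] at h
    exact le_of_mul_le_mul_left h hr
  · rintro ⟨x, hx, rfl⟩
    have h : dist x Q.center ≤ Q.radius := hx
    change dist (C.affineMap x) (C.affineMap Q.center) ≤ 2 * C.radius * Q.radius
    rw [key]
    exact mul_le_mul_of_nonneg_left h hr.le

end Cube

/-! ### The building block -/

/-- The square `[1/4, 3/4]² × {1/2}`, in which the planar continua are placed. -/
def baseSquare : Set Space3 :=
  {x | x 0 ∈ Set.Icc (1 / 4 : ℝ) (3 / 4) ∧ x 1 ∈ Set.Icc (1 / 4 : ℝ) (3 / 4) ∧ x 2 = 1 / 2}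

/-- The cube of radius `2 ^ (-2k-1)` centred at `p + (0, 0, 2 ^ (-2k))`. -/
noncomputable def hangingCube (k : ℕ) (p : Space3) : Cube where
  center := p + ![0, 0, (1 / 2) ^ (2 * k)]
  radius := (1 / 2) ^ (2 * k + 1)
  radius_pos := by positivity

/-- The `k`-th cube of the block with dense sequence `d`. The sequence `d 0, d 1, d 2, …` is
enumerated from `0`, while the sizes of the cubes are counted from `1`, whence the shift. -/
noncomputable def blockCube (d : ℕ → Space3) (k : ℕ) : Cube := hangingCube (k + 1) (d k)

/-- The building block: the continuum `E` together with the sequence of cubes approaching it. -/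
def block (E : Set Space3) (d : ℕ → Space3) : Set Space3 :=
  E ∪ ⋃ k, (blockCube d k).toSet

/-! ### The recursive construction

A finite word of length `n` over `ℕ` is a function `f : Fin n → ℕ`; `E n f` is the continuum and
`d n f` the enumerated dense subset assigned to that word. -/

/-- The cube `F_f` for a word `f`: the cube of the empty word is `[0,1]³`, and the cube of the
word `f` followed by `k` is the `k`-th cube of the block of `f`, relativized to the cube of `f`. -/
noncomputable def wordCube (d : (n : ℕ) → (Fin n → ℕ) → ℕ → Space3) :
    (n : ℕ) → (Fin n → ℕ) → Cube
  | 0, _ => Cube.unit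
  | n + 1, f =>
      (wordCube d n (Fin.init f)).relCube (blockCube (d n (Fin.init f)) (f (Fin.last n)))

/-- The decreasing sequence of sets `X_n`, starting with `X_0 = [0,1]³`; in each step, all cubes
of words of length `n` are replaced by relativized blocks. -/
def stage (E : (n : ℕ) → (Fin n → ℕ) → Set Space3)
    (d : (n : ℕ) → (Fin n → ℕ) → ℕ → Space3) : ℕ → Set Space3
  | 0 => Cube.unit.toSet
  | n + 1 =>
      (stage E d n \ ⋃ f : Fin n → ℕ, (wordCube d n f).toSet) ∪
        ⋃ f : Fin n → ℕ, (wordCube d n f).relativize (block (E n f) (d n f))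

/-- The space obtained as the intersection of all the `X_n`. -/
def limitSpace (E : (n : ℕ) → (Fin n → ℕ) → Set Space3)
    (d : (n : ℕ) → (Fin n → ℕ) → ℕ → Space3) : Set Space3 :=
  ⋂ n, stage E d n

/-- The space in which the same block, with basis `E n`, is used for all words of length `n`. -/
def levelSpace (E : ℕ → Set Space3) (d : ℕ → ℕ → Space3) : Set Space3 :=
  limitSpace (fun n _ => E n) (fun n _ => d n)

/-!
Let `Y n` be the space built from the continua `E n, E (n + 1), …`, so that the space of the theorem
is `Y 0`. Reading words from their first letter shows that `Y n` is the union of `E n` and of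
disjoint clopen scaled copies of `Y (n + 1)`, infinitely many of which lie near any given point of
`E n` (`levelSpace_eq`, `levelTower`). The topological part of the proof uses only this
self-similarity, which is recorded in the structure `CellTower`.

*Not reconstructible.* Every point `x` of `Y 0` lies either in the core of some cell or in cells of
all levels. In both cases there are pairwise disjoint clopen copies of `Y 1, Y 2, Y 3, …` that avoid
`x` and converge to it (`CellTower.exists_cells_setsConvergeTo`). Moreover `Y n ⊕ Y (n + 1) ≃ₜ Y n`:
copies of `Y (n + 1)` converge to a point of the core of `Y n`, and shifting them along the sequence
makes room for one more (`CellTower.sum_succ_homeomorph`). Let `S = Y 2 ⊕ Y 3 ⊕ ⋯`. Absorbing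
`Y (m + 2)` into the copy of `Y (m + 1)` near `x`, for every `m`, gives `{x}ᶜ ⊕ S ≃ₜ {x}ᶜ`. Hence
`Y 0` and the non-compact space `Y 0 ⊕ S` have the same deck; for a point removed from `S`,
interchange a summand of `S` with a copy of it inside `Y 0` (`not_isReconstructible_of_absorbs`).

*No constant universal sequence.* A nondegenerate connected subset of `Y n` lies in a copy of some
`E m` with `m ≥ n` (`CellTower.exists_subset_image_core`), because descending to a subcell enlarges it
fourfold. Any nonempty clopen subset of `Y 0` contains a cell, hence has a component homeomorphic to
some `E m`. The clopen sets that converge to a point lying in cells of all levels are eventually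
contained in a cell of level `m + 1`, so they have no such component.
-/

open Filter

/-! ### Homeomorphisms between disjoint sums -/

/-- A family of homeomorphisms induces a homeomorphism of the disjoint sums. -/
def Homeomorph.sigmaMapRight {ι : Type*} {P Q : ι → Type*} [∀ i, TopologicalSpace (P i)]
    [∀ i, TopologicalSpace (Q i)] (h : ∀ i, P i ≃ₜ Q i) : (Σ i, P i) ≃ₜ Σ i, Q i where
  toEquiv := Equiv.sigmaCongrRight fun i => (h i).toEquiv
  continuous_toFun := continuous_sigma fun i => continuous_sigmaMk.comp (h i).continuous
  continuous_invFun := continuous_sigma fun i => continuous_sigmaMk.comp (h i).symm.continuous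

/-- Disjoint sums of two families can be formed index by index. -/
def Homeomorph.sigmaSumSigma {ι : Type*} (P Q : ι → Type*) [∀ i, TopologicalSpace (P i)]
    [∀ i, TopologicalSpace (Q i)] : ((Σ i, P i) ⊕ Σ i, Q i) ≃ₜ Σ i, P i ⊕ Q i where
  toEquiv := (Equiv.sigmaSumDistrib P Q).symm
  continuous_toFun := continuous_sumElim.2
    ⟨continuous_sigma fun i => show Continuous fun p : P i => (⟨i, .inl p⟩ : Σ i, P i ⊕ Q i) from
        continuous_sigmaMk.comp continuous_inl,
      continuous_sigma fun i => show Continuous fun q : Q i => (⟨i, .inr q⟩ : Σ i, P i ⊕ Q i) from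
        continuous_sigmaMk.comp continuous_inr⟩
  continuous_invFun := continuous_sigma fun _ => continuous_sumElim.2
    ⟨continuous_inl.comp continuous_sigmaMk, continuous_inr.comp continuous_sigmaMk⟩

/-- Two disjoint clopen copies of a space can be interchanged by a homeomorphism. -/
theorem exists_homeomorph_swap {T Z : Type*} [TopologicalSpace T] [TopologicalSpace Z]
    {i j : T → Z} (hi : IsOpenEmbedding i) (hj : IsOpenEmbedding j) (hi' : IsClosed (range i))
    (hj' : IsClosed (range j)) (hij : Disjoint (range i) (range j)) (t : T) :
    ∃ e : Z ≃ₜ Z, e (i t) = j t := by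
  classical
  have hne : ∀ a b, i a ≠ j b := fun a b h =>
    disjoint_left.1 hij (mem_range_self a) (h ▸ mem_range_self b)
  let s : Z → Z := fun z =>
    if h : z ∈ range i then j h.choose else if h : z ∈ range j then i h.choose else z
  have si : ∀ a, s (i a) = j a := fun a => by
    have h : i a ∈ range i := mem_range_self a
    simp only [s, dif_pos h]
    rw [hi.injective h.choose_spec]
  have sj : ∀ a, s (j a) = i a := fun a => by
    have h : j a ∈ range j := mem_range_self a
    have h' : j a ∉ range i := fun ⟨b, hb⟩ => hne b a hb
    simp only [s, dif_pos h, dif_neg h']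
    rw [hj.injective h.choose_spec]
  have s0 : ∀ z, z ∉ range i → z ∉ range j → s z = z := fun z h h' => by
    simp only [s, dif_neg h, dif_neg h']
  have hinv : Function.Involutive s := fun z => by
    by_cases h : z ∈ range i
    · obtain ⟨a, rfl⟩ := h
      rw [si, sj]
    by_cases h' : z ∈ range j
    · obtain ⟨a, rfl⟩ := h'
      rw [sj, si]
    rw [s0 z h h', s0 z h h']
  have hc : Continuous s := by
    refine continuous_iff_continuousAt.2 fun z => ?_
    by_cases h : z ∈ range i
    · obtain ⟨a, rfl⟩ := h
      rw [← hi.continuousAt_iff]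
      exact (hj.continuous.congr fun b => (si b).symm).continuousAt
    by_cases h' : z ∈ range j
    · obtain ⟨a, rfl⟩ := h'
      rw [← hj.continuousAt_iff]
      exact (hi.continuous.congr fun b => (sj b).symm).continuousAt
    refine continuousAt_id.congr ?_
    filter_upwards [hi'.isOpen_compl.mem_nhds h, hj'.isOpen_compl.mem_nhds h'] with w hw hw'
    exact (s0 w hw hw').symm
  exact ⟨⟨hinv.toPerm, hc, hc⟩, si t⟩

/-! ### Sequences of clopen sets converging to a point -/

section Converge

variable {X : Type*} [TopologicalSpace X]

/-- Adding the limit point to the union of a convergent sequence of closed sets gives a closed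
set. -/
theorem SetsConvergeTo.isClosed_insert_iUnion [T2Space X] {B : ℕ → Set X} {x : X}
    (h : SetsConvergeTo B x) (hB : ∀ n, IsClosed (B n)) : IsClosed (insert x (⋃ n, B n)) := by
  rw [← isOpen_compl_iff, isOpen_iff_mem_nhds]
  intro y hy
  simp only [mem_compl_iff, mem_insert_iff, mem_iUnion, not_or, not_exists] at hy
  obtain ⟨U, V, hU, hV, hxU, hyV, hUV⟩ := t2_separation (Ne.symm hy.1)
  obtain ⟨N, hN⟩ := h U (hU.mem_nhds hxU)
  have hfin : ∀ᶠ z in 𝓝 y, ∀ n ∈ Finset.range N, z ∉ B n :=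
    (Finset.eventually_all _).2 fun n _ => (hB n).isOpen_compl.mem_nhds (hy.2 n)
  filter_upwards [hfin, hV.mem_nhds hyV] with z hz hzV
  simp only [mem_compl_iff, mem_insert_iff, mem_iUnion, not_or, not_exists]
  refine ⟨fun hzx => disjoint_left.1 hUV (hzx ▸ hxU) hzV, fun n hn => ?_⟩
  rcases lt_or_ge n N with hnN | hnN
  · exact hz n (Finset.mem_range.2 hnN) hn
  · exact disjoint_left.1 hUV (hN n hnN hn) hzV

/-- A punctured space splits along a sequence of clopen sets converging to the puncture. -/
theorem SetsConvergeTo.exists_compl_homeomorph [T2Space X] {P : ℕ → Type*}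
    [∀ n, TopologicalSpace (P n)] {g : ∀ n, P n → X} {x : X}
    (h : SetsConvergeTo (fun n => range (g n)) x) (hg : ∀ n, IsOpenEmbedding (g n))
    (hcl : ∀ n, IsClosed (range (g n))) (hx : ∀ n, x ∉ range (g n))
    (hdisj : Pairwise fun m n => Disjoint (range (g m)) (range (g n))) :
    Nonempty (({x}ᶜ : Set X) ≃ₜ
      ((insert x (⋃ n, range (g n)))ᶜ : Set X) ⊕ Σ n, P n) := by
  have hA : IsOpen ((insert x (⋃ n, range (g n)))ᶜ : Set X) :=
    (h.isClosed_insert_iUnion hcl).isOpen_compl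
  have hsub : (insert x (⋃ n, range (g n)))ᶜ ⊆ ({x}ᶜ : Set X) :=
    compl_subset_compl.2 (singleton_subset_iff.2 (mem_insert _ _))
  let F : ((insert x (⋃ n, range (g n)))ᶜ : Set X) ⊕ (Σ n, P n) → ({x}ᶜ : Set X) :=
    Sum.elim (fun a => ⟨a, hsub a.2⟩) fun p => ⟨g p.1 p.2, fun hp => hx p.1 ⟨p.2, hp⟩⟩
  have hF1 : ∀ n, Continuous fun p : P n => (F (.inr ⟨n, p⟩)) := fun n =>
    (hg n).continuous.subtype_mk _
  have hF : IsHomeomorph F := by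
    refine ⟨?_, ?_, ?_, ?_⟩
    · exact continuous_sumElim.2 ⟨continuous_subtype_val.subtype_mk _, continuous_sigma hF1⟩
    · refine isOpenMap_sum.2 ⟨?_, isOpenMap_sigma.2 fun n => ?_⟩
      · exact hA.isOpenMap_subtype_val.subtype_mk _
      · exact (hg n).isOpenMap.subtype_mk _
    · rintro (a | ⟨m, p⟩) (b | ⟨n, q⟩) hab
      · exact congrArg _ (Subtype.ext (congrArg Subtype.val hab :))
      · exact (a.2 (mem_insert_of_mem _ (mem_iUnion.2 ⟨n, q, (congrArg Subtype.val hab).symm⟩))).elim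
      · exact (b.2 (mem_insert_of_mem _ (mem_iUnion.2 ⟨m, p, congrArg Subtype.val hab⟩))).elim
      · have hab' : g m p = g n q := congrArg Subtype.val hab
        have hmn : m = n := by
          by_contra hmn
          exact disjoint_left.1 (hdisj hmn) (mem_range_self p) (hab' ▸ mem_range_self q)
        subst hmn
        rw [(hg m).injective hab']
    · rintro ⟨y, hy⟩
      by_cases hyu : y ∈ ⋃ n, range (g n)
      · obtain ⟨n, p, rfl⟩ := mem_iUnion.1 hyu
        exact ⟨.inr ⟨n, p⟩, rfl⟩
      · exact ⟨.inl ⟨y, fun h' => h'.elim hy hyu⟩, rfl⟩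
  exact ⟨(hF.homeomorph F).symm⟩

/-- If clopen copies of the `P n` converge to `x` and every `P n` absorbs `Q n`, then the space
punctured at `x` absorbs the disjoint sum of all `Q n`. -/
theorem SetsConvergeTo.compl_sum_homeomorph [T2Space X] {P Q : ℕ → Type*}
    [∀ n, TopologicalSpace (P n)] [∀ n, TopologicalSpace (Q n)] {g : ∀ n, P n → X} {x : X}
    (h : SetsConvergeTo (fun n => range (g n)) x) (hg : ∀ n, IsOpenEmbedding (g n))
    (hcl : ∀ n, IsClosed (range (g n))) (hx : ∀ n, x ∉ range (g n))
    (hdisj : Pairwise fun m n => Disjoint (range (g m)) (range (g n)))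
    (habs : ∀ n, Nonempty (P n ⊕ Q n ≃ₜ P n)) :
    Nonempty (({x}ᶜ : Set X) ⊕ (Σ n, Q n) ≃ₜ ({x}ᶜ : Set X)) := by
  obtain ⟨e⟩ := h.exists_compl_homeomorph hg hcl hx hdisj
  refine ⟨(e.sumCongr (.refl _)).trans ((Homeomorph.sumAssoc _ _ _).trans
    (((Homeomorph.refl _).sumCongr ((Homeomorph.sigmaSumSigma P Q).trans
      (Homeomorph.sigmaMapRight fun n => (habs n).some))).trans e.symm))⟩

/-- A compact space with a sequence of clopen copies of `T` converging to one of its points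
absorbs a further copy of `T`: the given copies are shifted along the sequence. -/
theorem SetsConvergeTo.sum_homeomorph [T2Space X] [CompactSpace X] {T : Type*}
    [TopologicalSpace T] [CompactSpace T] {g : ℕ → T → X} {x : X}
    (h : SetsConvergeTo (fun n => range (g n)) x) (hg : ∀ n, IsOpenEmbedding (g n))
    (hx : ∀ n, x ∉ range (g n))
    (hdisj : Pairwise fun m n => Disjoint (range (g m)) (range (g n))) :
    Nonempty (X ⊕ T ≃ₜ X) := by
  classical
  have hcl : ∀ n, IsClosed (range (g n)) := fun n => (isCompact_range (hg n).continuous).isClosed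
  have huniq : ∀ m n s t, g m s = g n t → m = n ∧ s = t := fun m n s t hst => by
    have hmn : m = n := by
      by_contra hmn
      exact disjoint_left.1 (hdisj hmn) (mem_range_self s) (hst ▸ mem_range_self t)
    subst hmn
    exact ⟨rfl, (hg m).injective hst⟩
  let s : X → X := fun y =>
    if hy : ∃ p : ℕ × T, g p.1 p.2 = y then g (hy.choose.1 + 1) hy.choose.2 else y
  have sg : ∀ n t, s (g n t) = g (n + 1) t := fun n t => by
    have hy : ∃ p : ℕ × T, g p.1 p.2 = g n t := ⟨(n, t), rfl⟩
    obtain ⟨h1, h2⟩ := huniq _ _ _ _ hy.choose_spec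
    simp only [s, dif_pos hy]
    rw [h1, h2]
  have s0 : ∀ y, (∀ n, y ∉ range (g n)) → s y = y := fun y hy => by
    have : ¬∃ p : ℕ × T, g p.1 p.2 = y := fun ⟨p, hp⟩ => hy p.1 ⟨p.2, hp⟩
    simp only [s, dif_neg this]
  have hs : Continuous s := by
    refine continuous_iff_continuousAt.2 fun y => ?_
    by_cases hy : ∃ n, y ∈ range (g n)
    · obtain ⟨n, t, rfl⟩ := hy
      rw [← (hg n).continuousAt_iff]
      exact ((hg (n + 1)).continuous.congr fun b => (sg n b).symm).continuousAt
    push Not at hy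
    by_cases hyx : y = x
    · subst hyx
      rw [ContinuousAt, s0 _ hx]
      intro U hU
      obtain ⟨N, hN⟩ := h U hU
      have hfin : ∀ᶠ z in 𝓝 y, ∀ n ∈ Finset.range N, z ∉ range (g n) :=
        (Finset.eventually_all _).2 fun n _ => (hcl n).isOpen_compl.mem_nhds (hx n)
      rw [mem_map]
      filter_upwards [hfin, hU] with z hz hzU
      by_cases hzg : ∃ n, z ∈ range (g n)
      · obtain ⟨n, t, rfl⟩ := hzg
        have hn : N ≤ n := by
          by_contra hn
          exact hz n (Finset.mem_range.2 (not_le.1 hn)) (mem_range_self t)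
        exact mem_preimage.2 (sg n t ▸ hN (n + 1) (by omega) (mem_range_self t))
      · push Not at hzg
        exact mem_preimage.2 ((s0 z hzg).symm ▸ hzU)
    · refine continuousAt_id.congr ?_
      have hy' : y ∉ insert x (⋃ n, range (g n)) := fun h' =>
        h'.elim hyx fun h'' => (mem_iUnion.1 h'').elim hy
      filter_upwards [(h.isClosed_insert_iUnion hcl).isOpen_compl.mem_nhds hy'] with z hz
      exact (s0 z fun n hn => hz (mem_insert_of_mem _ (mem_iUnion.2 ⟨n, hn⟩))).symm
  have hbij : Function.Bijective (Sum.elim s (g 0)) := by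
    constructor
    · have key : ∀ y, s y = y ∧ (∀ n, y ∉ range (g n)) ∨ ∃ n t, y = g n t := fun y => by
        by_cases hy : ∃ n, y ∈ range (g n)
        · obtain ⟨n, t, rfl⟩ := hy
          exact .inr ⟨n, t, rfl⟩
        · push Not at hy
          exact .inl ⟨s0 y hy, hy⟩
      have key' : ∀ y t, s y ≠ g 0 t := fun y t hyt => by
        rcases key y with ⟨h1, h2⟩ | ⟨n, u, rfl⟩
        · exact h2 0 ⟨t, by rw [← hyt, h1]⟩
        · rw [sg] at hyt
          exact absurd (huniq _ _ _ _ hyt).1 (by omega)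
      rintro (y | t) (z | u) hyz <;> simp only [Sum.elim_inl, Sum.elim_inr] at hyz
      · rcases key y with ⟨h1, h2⟩ | ⟨n, u, rfl⟩ <;> rcases key z with ⟨h3, h4⟩ | ⟨m, v, rfl⟩
        · rw [h1, h3] at hyz
          rw [hyz]
        · rw [h1, sg] at hyz
          exact (h2 _ ⟨v, hyz.symm⟩).elim
        · rw [h3, sg] at hyz
          exact (h4 _ ⟨u, hyz⟩).elim
        · rw [sg, sg] at hyz
          obtain ⟨h1, h2⟩ := huniq _ _ _ _ hyz
          rw [Nat.succ_injective h1, h2]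
      · exact (key' _ _ hyz).elim
      · exact (key' _ _ hyz.symm).elim
      · rw [(huniq _ _ _ _ hyz).2]
    · intro y
      by_cases hy : ∃ n, y ∈ range (g n)
      · obtain ⟨n, t, rfl⟩ := hy
        rcases n with _ | n
        · exact ⟨.inr t, rfl⟩
        · exact ⟨.inl (g n t), sg n t⟩
      · push Not at hy
        exact ⟨.inl y, s0 y hy⟩
  exact ⟨Continuous.homeoOfEquivCompactToT2 (f := Equiv.ofBijective _ hbij)
    (continuous_sumElim.2 ⟨hs, (hg 0).continuous⟩)⟩

end Converge

/-! ### A criterion for non-reconstructibility -/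

/-- A compact space `X` is not reconstructible if all its punctured subspaces absorb a fixed
disjoint sum of infinitely many spaces that embed into `X` as clopen sets. The witness is the
non-compact space `X ⊕ Σ n, Q n`. -/
theorem not_isReconstructible_of_absorbs.{u} {X : Type u} [TopologicalSpace X] [T2Space X]
    [CompactSpace X] {Q : ℕ → Type u} [∀ n, TopologicalSpace (Q n)] [∀ n, CompactSpace (Q n)]
    [∀ n, Nonempty (Q n)] (hQ : ∀ n, ∃ i : Q n → X, IsOpenEmbedding i)
    (habs : ∀ x : X, Nonempty (({x}ᶜ : Set X) ⊕ (Σ n, Q n) ≃ₜ ({x}ᶜ : Set X))) :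
    ¬ IsReconstructible X := by
  intro hrec
  have hinl : ∀ x : X, Nonempty (({x}ᶜ : Set X) ≃ₜ ({.inl x}ᶜ : Set (X ⊕ Σ n, Q n))) := by
    intro x
    let G : ({x}ᶜ : Set X) ⊕ (Σ n, Q n) → ({.inl x}ᶜ : Set (X ⊕ Σ n, Q n)) :=
      Sum.elim (fun a => ⟨.inl a, fun h => a.2 (Sum.inl_injective h)⟩)
        fun p => ⟨.inr p, fun h => Sum.inr_ne_inl h⟩
    have hG : IsHomeomorph G := by
      refine ⟨continuous_sumElim.2 ⟨(continuous_inl.comp continuous_subtype_val).subtype_mk _,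
        continuous_inr.subtype_mk _⟩, isOpenMap_sum.2 ⟨?_, ?_⟩, ?_, ?_⟩
      · exact (isOpenMap_inl.comp isOpen_compl_singleton.isOpenMap_subtype_val).subtype_mk _
      · exact isOpenMap_inr.subtype_mk _
      · rintro (a | p) (b | q) hab
        · exact congrArg _ (Subtype.ext (Sum.inl_injective (congrArg Subtype.val hab)))
        · exact (Sum.inl_ne_inr (congrArg Subtype.val hab)).elim
        · exact (Sum.inr_ne_inl (congrArg Subtype.val hab)).elim
        · exact congrArg _ (Sum.inr_injective (congrArg Subtype.val hab))
      · rintro ⟨a | p, hz⟩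
        · exact ⟨.inl ⟨a, fun h => hz (congrArg _ h)⟩, rfl⟩
        · exact ⟨.inr p, rfl⟩
    exact ⟨(habs x).some.symm.trans (hG.homeomorph G)⟩
  have hdeck : SameDeck X (X ⊕ Σ n, Q n) := by
    refine ⟨fun x => ⟨.inl x, hinl x⟩, ?_⟩
    rintro (x | ⟨n, q⟩)
    · exact ⟨x, hinl x⟩
    -- A point of the `n`-th summand is moved into a copy of that summand inside `X`.
    obtain ⟨i, hi⟩ := hQ n
    have hj : IsOpenEmbedding fun q : Q n => (.inl (i q) : X ⊕ Σ n, Q n) :=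
      IsOpenEmbedding.inl.comp hi
    have hk : IsOpenEmbedding fun q : Q n => (.inr ⟨n, q⟩ : X ⊕ Σ n, Q n) :=
      IsOpenEmbedding.inr.comp IsOpenEmbedding.sigmaMk
    obtain ⟨e, he⟩ := exists_homeomorph_swap hj hk
      (by
        rw [range_comp' Sum.inl i]
        exact IsClosedEmbedding.inl.isClosedMap _ (isCompact_range hi.continuous).isClosed)
      (IsClosedEmbedding.inr.comp IsClosedEmbedding.sigmaMk).isClosed_range
      (disjoint_left.2 fun z ⟨a, ha⟩ ⟨b, hb⟩ => Sum.inl_ne_inr (ha.trans hb.symm)) q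
    refine ⟨i q, ⟨(hinl (i q)).some.trans (e.sets ?_)⟩⟩
    rw [← he]
    ext z
    simp [e.injective.eq_iff]
  obtain ⟨e⟩ := hrec _ hdeck
  have : CompactSpace (X ⊕ Σ n, Q n) := e.symm.compactSpace
  have hc : Continuous (Sum.elim (fun _ => 0) Sigma.fst : X ⊕ (Σ n, Q n) → ℕ) :=
    continuous_sumElim.2 ⟨continuous_const, continuous_sigma fun _ => continuous_const⟩
  have hfin := (isCompact_range hc).finite_of_discrete
  refine (infinite_univ (α := ℕ)).mono (fun n _ => ?_) hfin
  exact ⟨.inr ⟨n, Classical.arbitrary _⟩, rfl⟩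

/-! ### Cell towers -/

/-- An abstract form of the recursive construction: a sequence of metric spaces `Y 0, Y 1, …` of
diameter at most `1`, where `Y n` consists of a nondegenerate connected set `core n` and of
disjoint open copies `incl n k` of `Y (n + 1)`, one for each `k`, that are at least four times
smaller than `Y (n + 1)` and accumulate at every point of the core. -/
structure CellTower.{u} (Y : ℕ → Type u) [∀ n, MetricSpace (Y n)] where
  core : ∀ n, Set (Y n)
  incl : ∀ n, ℕ → Y (n + 1) → Y n
  isConnected_core : ∀ n, IsConnected (core n)
  nontrivial_core : ∀ n, (core n).Nontrivial
  isOpenEmbedding_incl : ∀ n k, IsOpenEmbedding (incl n k)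
  disjoint_range_incl : ∀ n, Pairwise fun j k => Disjoint (range (incl n j)) (range (incl n k))
  compl_core : ∀ n, (core n)ᶜ = ⋃ k, range (incl n k)
  frequently_range_incl_subset : ∀ n, ∀ y ∈ core n, ∀ U ∈ 𝓝 y,
    ∃ᶠ k in atTop, range (incl n k) ⊆ U
  dist_incl_le : ∀ n k x y, dist (incl n k x) (incl n k y) ≤ dist x y / 4
  dist_le_one : ∀ n (x y : Y n), dist x y ≤ 1

namespace CellTower

universe u

variable {Y : ℕ → Type u} [∀ n, MetricSpace (Y n)] (S : CellTower Y)

theorem nonempty (S : CellTower Y) (n : ℕ) : Nonempty (Y n) :=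
  (S.isConnected_core n).nonempty.to_type

theorem exists_incl_eq {n : ℕ} {y : Y n} (hy : y ∉ S.core n) :
    ∃ (k : ℕ) (z : Y (n + 1)), S.incl n k z = y := by
  have h : y ∈ (S.core n)ᶜ := hy
  rw [S.compl_core n] at h
  exact mem_iUnion.1 h

theorem incl_notMem_core {n k : ℕ} (z : Y (n + 1)) : S.incl n k z ∉ S.core n := by
  change S.incl n k z ∈ (S.core n)ᶜ
  rw [S.compl_core n]
  exact mem_iUnion.2 ⟨k, z, rfl⟩

theorem isClosed_range_incl [∀ n, CompactSpace (Y n)] (n k : ℕ) :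
    IsClosed (range (S.incl n k)) :=
  (isCompact_range (S.isOpenEmbedding_incl n k).continuous).isClosed

theorem incl_injective2 {n j k : ℕ} {y z : Y (n + 1)} (h : S.incl n j y = S.incl n k z) :
    j = k ∧ y = z := by
  have hjk : j = k := by
    by_contra hjk
    exact disjoint_left.1 (S.disjoint_range_incl n hjk) (mem_range_self y) (h ▸ mem_range_self z)
  subst hjk
  exact ⟨rfl, (S.isOpenEmbedding_incl n j).injective h⟩

/-- Every core point is the limit of a sequence of the copies around it. -/
theorem exists_strictMono_setsConvergeTo {n : ℕ} {y : Y n} (hy : y ∈ S.core n) :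
    ∃ κ : ℕ → ℕ, StrictMono κ ∧ SetsConvergeTo (fun i => range (S.incl n (κ i))) y := by
  obtain ⟨κ, hκ, h⟩ := extraction_forall_of_frequently fun i : ℕ =>
    S.frequently_range_incl_subset n y hy _
      (Metric.ball_mem_nhds y (Nat.one_div_pos_of_nat (α := ℝ) (n := i)))
  refine ⟨κ, hκ, fun U hU => ?_⟩
  obtain ⟨ε, hε, hεU⟩ := Metric.mem_nhds_iff.1 hU
  obtain ⟨N, hN⟩ := exists_nat_one_div_lt hε
  exact ⟨N, fun i hi => (h i).trans ((Metric.ball_subset_ball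
    ((Nat.one_div_le_one_div hi).trans hN.le)).trans hεU)⟩

/-- `Y n` absorbs a further copy of `Y (n + 1)`. -/
theorem sum_succ_homeomorph (S : CellTower Y) [∀ n, CompactSpace (Y n)] (n : ℕ) :
    Nonempty (Y n ⊕ Y (n + 1) ≃ₜ Y n) := by
  obtain ⟨y, hy⟩ := (S.isConnected_core n).nonempty
  obtain ⟨κ, hκ, h⟩ := S.exists_strictMono_setsConvergeTo hy
  exact h.sum_homeomorph (fun i => S.isOpenEmbedding_incl n (κ i))
    (fun i ⟨z, hz⟩ => S.incl_notMem_core z (hz ▸ hy))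
    fun i j hij => S.disjoint_range_incl n (hκ.injective.ne hij)

/-! ### Cells -/

/-- The embedding of `Y m` into `Y 0` as the cell of level `m` with address
`(f 0, …, f (m - 1))`; the further values of `f` are ignored. -/
def cellMap : ∀ m : ℕ, (ℕ → ℕ) → Y m → Y 0
  | 0, _ => id
  | m + 1, f => cellMap m f ∘ S.incl m (f m)

theorem isOpenEmbedding_cellMap (m : ℕ) (f : ℕ → ℕ) : IsOpenEmbedding (S.cellMap m f) := by
  induction m with
  | zero => exact .id
  | succ m ih => exact ih.comp (S.isOpenEmbedding_incl m (f m))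

theorem isClosed_range_cellMap [∀ n, CompactSpace (Y n)] (m : ℕ) (f : ℕ → ℕ) :
    IsClosed (range (S.cellMap m f)) :=
  (isCompact_range (S.isOpenEmbedding_cellMap m f).continuous).isClosed

theorem cellMap_congr {m : ℕ} {f g : ℕ → ℕ} (h : ∀ i < m, f i = g i) :
    S.cellMap m f = S.cellMap m g := by
  induction m with
  | zero => rfl
  | succ m ih =>
    rw [cellMap, cellMap, ih fun i hi => h i (hi.trans m.lt_succ_self), h m m.lt_succ_self]

theorem range_cellMap_anti {m n : ℕ} (h : m ≤ n) (f : ℕ → ℕ) :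
    range (S.cellMap n f) ⊆ range (S.cellMap m f) := by
  induction n, h using Nat.le_induction with
  | base => rfl
  | succ n _ ih => exact (range_comp_subset_range _ _).trans ih

theorem dist_cellMap_le (m : ℕ) (f : ℕ → ℕ) (y z : Y m) :
    dist (S.cellMap m f y) (S.cellMap m f z) ≤ (1 / 4) ^ m := by
  suffices h : dist (S.cellMap m f y) (S.cellMap m f z) ≤ (1 / 4) ^ m * dist y z from
    h.trans (mul_le_of_le_one_right (by positivity) (S.dist_le_one m y z))
  induction m with
  | zero => simp [cellMap]
  | succ m ih =>
    refine (ih _ _).trans ?_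
    rw [pow_succ, mul_assoc]
    have := S.dist_incl_le m (f m) y z
    gcongr
    linarith

/-- Cells with incomparable addresses are disjoint. -/
theorem disjoint_range_cellMap {m n j : ℕ} {f g : ℕ → ℕ} (hm : j < m) (hn : j < n)
    (hfg : f j ≠ g j) : Disjoint (range (S.cellMap m f)) (range (S.cellMap n g)) := by
  classical
  have hex : ∃ i, f i ≠ g i := ⟨j, hfg⟩
  have hij : Nat.find hex ≤ j := Nat.find_min' hex hfg
  have hi : f (Nat.find hex) ≠ g (Nat.find hex) := Nat.find_spec hex
  have hlt : ∀ l < Nat.find hex, f l = g l := fun l hl => not_not.1 (Nat.find_min hex hl)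
  generalize Nat.find hex = i at hij hi hlt
  refine Disjoint.mono (S.range_cellMap_anti (show i + 1 ≤ m by omega) f)
    (S.range_cellMap_anti (show i + 1 ≤ n by omega) g) (disjoint_left.2 ?_)
  rintro _ ⟨y, rfl⟩ ⟨z, hz⟩
  rw [cellMap, cellMap, S.cellMap_congr hlt] at hz
  exact hi (S.incl_injective2 ((S.isOpenEmbedding_cellMap i g).injective hz)).1.symm

/-- A point of `Y 0` lies in the core of some cell or in cells of all levels. -/
theorem exists_address (x : Y 0) : ∃ f : ℕ → ℕ,
    (∃ n, ∃ y ∈ S.core n, S.cellMap n f y = x) ∨ ∀ n, x ∈ range (S.cellMap n f) := by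
  classical
  have hstep : ∀ n (y : Y n), ∃ p : ℕ × Y (n + 1), y ∉ S.core n → S.incl n p.1 p.2 = y := by
    intro n y
    by_cases hy : y ∈ S.core n
    · exact ⟨(0, (S.nonempty (n + 1)).some), fun h => (h hy).elim⟩
    · obtain ⟨k, z, hz⟩ := S.exists_incl_eq hy
      exact ⟨(k, z), fun _ => hz⟩
  choose p hp using hstep
  -- The point `pt n` of `Y n` corresponds to `x`, as long as no core has been reached.
  let pt : ∀ n, Y n := fun n => Nat.rec x (fun n y => (p n y).2) n
  have hpt : ∀ n, (∀ i < n, pt i ∉ S.core i) →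
      S.cellMap n (fun n => (p n (pt n)).1) (pt n) = x := by
    intro n
    induction n with
    | zero => exact fun _ => rfl
    | succ n ih =>
      intro h
      have h1 := hp n (pt n) (h n n.lt_succ_self)
      rw [← ih fun i hi => h i (hi.trans n.lt_succ_self)]
      exact congrArg _ h1
  refine ⟨fun n => (p n (pt n)).1, ?_⟩
  by_cases hex : ∃ n, pt n ∈ S.core n
  · exact .inl ⟨Nat.find hex, pt _, Nat.find_spec hex, hpt _ fun i hi => Nat.find_min hex hi⟩
  · push Not at hex
    exact .inr fun n => ⟨pt n, hpt n fun i _ => hex i⟩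

/-- Sets in the successive cells around `x` converge to `x`, since the cells shrink. -/
theorem setsConvergeTo_of_subset_range_cellMap {B : ℕ → Set (Y 0)} {x : Y 0} {f : ℕ → ℕ}
    (hx : ∀ n, x ∈ range (S.cellMap n f)) (hB : ∀ n, B n ⊆ range (S.cellMap n f)) :
    SetsConvergeTo B x := by
  intro U hU
  obtain ⟨ε, hε, hεU⟩ := Metric.mem_nhds_iff.1 hU
  obtain ⟨N, hN⟩ := exists_pow_lt_of_lt_one hε (show (1 / 4 : ℝ) < 1 by norm_num)
  refine ⟨N, fun n hn y hy => hεU ?_⟩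
  obtain ⟨z, rfl⟩ := S.range_cellMap_anti hn f (hB n hy)
  obtain ⟨w, rfl⟩ := hx N
  exact Metric.mem_ball.2 ((S.dist_cellMap_le N f z w).trans_lt hN)

/-- Every point of `Y 0` is the limit of pairwise disjoint cells of levels `1, 2, 3, …`. -/
theorem exists_cells_setsConvergeTo (x : Y 0) : ∃ w : ℕ → ℕ → ℕ,
    SetsConvergeTo (fun m => range (S.cellMap (m + 1) (w m))) x ∧
      (∀ m, x ∉ range (S.cellMap (m + 1) (w m))) ∧
      Pairwise fun m n => Disjoint (range (S.cellMap (m + 1) (w m)))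
        (range (S.cellMap (n + 1) (w n))) := by
  obtain ⟨f, ⟨n, y, hy, rfl⟩ | hx⟩ := S.exists_address x
  · -- Below level `n`, take siblings of the cells around `x`; from then on, take cells inside the
    -- copies that converge to the core point.
    obtain ⟨κ, hκ, hconv⟩ := S.exists_strictMono_setsConvergeTo hy
    let w : ℕ → ℕ → ℕ := fun m =>
      if m < n then Function.update f m (f m + 1) else Function.update f n (κ (m - n))
    have hw1 : ∀ m < n, w m = Function.update f m (f m + 1) := fun m hm => if_pos hm
    have hw2 : ∀ m, n ≤ m → w m = Function.update f n (κ (m - n)) := fun m hm =>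
      if_neg (not_lt.2 hm)
    have hsub : ∀ m, n ≤ m → range (S.cellMap (m + 1) (w m)) ⊆
        S.cellMap n f '' range (S.incl n (κ (m - n))) := fun m hm => by
      refine (S.range_cellMap_anti (show n + 1 ≤ m + 1 by omega) _).trans ?_
      rw [hw2 m hm, cellMap, range_comp, Function.update_self]
      rw [S.cellMap_congr fun i hi => Function.update_of_ne hi.ne _ _]
    refine ⟨w, ?_, fun m => ?_, fun a b hab => ?_⟩
    · intro U hU
      obtain ⟨N, hN⟩ := hconv _ ((S.isOpenEmbedding_cellMap n f).continuous.continuousAt hU)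
      refine ⟨N + n, fun m hm => (hsub m (by omega)).trans ?_⟩
      exact image_subset_iff.2 (hN (m - n) (by omega))
    · rcases lt_or_ge m n with hm | hm
      · refine disjoint_left.1 (S.disjoint_range_cellMap (j := m) hm m.lt_succ_self ?_)
          (mem_range_self y)
        rw [hw1 m hm, Function.update_self]
        omega
      · intro h
        obtain ⟨_, ⟨z, rfl⟩, hz⟩ := hsub m hm h
        exact S.incl_notMem_core z ((S.isOpenEmbedding_cellMap n f).injective hz ▸ hy)
    · wlog hlt : a < b generalizing a b
      · exact (this b a hab.symm (by omega)).symm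
      rcases lt_or_ge a n with ha | ha
      · refine S.disjoint_range_cellMap (j := a) a.lt_succ_self (by omega) ?_
        rw [hw1 a ha, Function.update_self]
        rcases lt_or_ge b n with hb | hb
        · rw [hw1 b hb, Function.update_of_ne hlt.ne]
          omega
        · rw [hw2 b hb, Function.update_of_ne ha.ne]
          omega
      · refine S.disjoint_range_cellMap (j := n) (by omega) (by omega) ?_
        rw [hw2 a ha, hw2 b (by omega), Function.update_self, Function.update_self]
        exact hκ.injective.ne (by omega)
  · -- If `x` lies in cells of all levels, take siblings of these cells throughout.
    have hw : ∀ m, range (S.cellMap (m + 1) (Function.update f m (f m + 1))) ⊆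
        range (S.cellMap m f) := fun m => by
      refine (S.range_cellMap_anti m.le_succ _).trans ?_
      rw [S.cellMap_congr fun i hi => Function.update_of_ne hi.ne _ _]
    refine ⟨fun m => Function.update f m (f m + 1),
      S.setsConvergeTo_of_subset_range_cellMap hx hw, fun m => ?_, fun a b hab => ?_⟩
    · refine disjoint_left.1 (S.disjoint_range_cellMap (j := m) m.lt_succ_self m.lt_succ_self ?_)
        (hx (m + 1))
      dsimp only
      rw [Function.update_self]
      omega
    · wlog hlt : a < b generalizing a b
      · exact (this b a hab.symm (by omega)).symm
      refine S.disjoint_range_cellMap (j := a) a.lt_succ_self (by omega) ?_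
      dsimp only
      rw [Function.update_self, Function.update_of_ne hlt.ne]
      omega

theorem not_isReconstructible (S : CellTower Y) [∀ n, CompactSpace (Y n)] :
    ¬ IsReconstructible (Y 0) := by
  -- The sum starts at level `2`, so that its `m`-th summand is absorbed by the cell of level `m + 1`.
  have (n : ℕ) : Nonempty (Y (n + 2)) := S.nonempty (n + 2)
  refine not_isReconstructible_of_absorbs (Q := fun n => Y (n + 2))
    (fun n => ⟨S.cellMap (n + 2) 0, S.isOpenEmbedding_cellMap _ _⟩) fun x => ?_
  obtain ⟨w, hconv, hx, hdisj⟩ := S.exists_cells_setsConvergeTo x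
  exact hconv.compl_sum_homeomorph (fun m => S.isOpenEmbedding_cellMap _ _)
    (fun m => S.isClosed_range_cellMap _ _) hx hdisj fun m => S.sum_succ_homeomorph (m + 1)

/-! ### Connected components -/

/-- A nondegenerate connected subset of `Y n` lies in a copy of the core of some level `m ≥ n`:
as long as it avoids the core, it lies in a copy of the next level, where it is four times
larger. -/
theorem exists_subset_image_core [∀ n, CompactSpace (Y n)] {n : ℕ} {D : Set (Y n)}
    (hD : IsPreconnected D) (hD' : D.Nontrivial) : ∃ m ≥ n, ∃ g : Y m → Y n,
      IsOpenEmbedding g ∧ D ⊆ g '' S.core m := by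
  obtain ⟨x, hx, y, hy, hxy⟩ := hD'
  obtain ⟨N, hN⟩ := exists_pow_lt_of_lt_one (dist_pos.2 hxy) (show (1 / 4 : ℝ) < 1 by norm_num)
  clear hxy
  induction N generalizing n with
  | zero => exact absurd (S.dist_le_one n x y) (not_le.2 (by simpa using hN))
  | succ N ih =>
    by_cases hDn : D ⊆ S.core n
    · exact ⟨n, le_rfl, id, .id, by rwa [image_id]⟩
    obtain ⟨z, hz, hzn⟩ := not_subset.1 hDn
    obtain ⟨k, z', rfl⟩ := S.exists_incl_eq hzn
    have hk := S.isOpenEmbedding_incl n k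
    have hDk : D ⊆ range (S.incl n k) :=
      hD.subset_isClopen ⟨S.isClosed_range_incl n k, hk.isOpen_range⟩ ⟨_, hz, mem_range_self _⟩
    obtain ⟨x', rfl⟩ := hDk hx
    obtain ⟨y', rfl⟩ := hDk hy
    have hdist := S.dist_incl_le n k x' y'
    obtain ⟨m, hm, g, hg, hgD⟩ := ih (hD.preimage_of_isOpenMap hk.injective hk.isOpenMap hDk)
      x' hx y' hy (by rw [pow_succ] at hN; linarith)
    refine ⟨m, by omega, S.incl n k ∘ g, hk.comp hg, fun v hv => ?_⟩
    obtain ⟨v', rfl⟩ := hDk hv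
    rw [image_comp]
    exact mem_image_of_mem _ (hgD hv)

variable {T : Type*} [TopologicalSpace T]

/-- In a clopen subspace, a component that is covered by a copy of a core is equal to it. -/
theorem nonempty_connectedComponent_homeomorph_core {n m : ℕ} {i : T → Y n}
    (hi : IsOpenEmbedding i) (hi' : IsClosed (range i)) {t : T} {g : Y m → Y n}
    (hg : IsOpenEmbedding g) (h : i '' connectedComponent t ⊆ g '' S.core m) :
    Nonempty (connectedComponent t ≃ₜ S.core m) := by
  have ht : i t ∈ g '' S.core m := h (mem_image_of_mem _ mem_connectedComponent)
  have hpre : IsPreconnected (g '' S.core m) :=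
    (S.isConnected_core m).isPreconnected.image _ hg.continuous.continuousOn
  have hsub : g '' S.core m ⊆ range i :=
    hpre.subset_isClopen ⟨hi', hi.isOpen_range⟩ ⟨_, ht, mem_range_self t⟩
  have heq : i '' connectedComponent t = g '' S.core m := by
    refine h.antisymm fun z hz => ?_
    obtain ⟨z', rfl⟩ := hsub hz
    exact mem_image_of_mem _ ((hpre.preimage_of_isOpenMap hi.injective hi.isOpenMap
      hsub).subset_connectedComponent ht hz)
  exact ⟨(hi.isEmbedding.homeomorphImage _).trans ((Homeomorph.setCongr heq).trans
    (hg.isEmbedding.homeomorphImage _).symm)⟩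

/-- In a clopen subspace, the component of a point of a copy of a core is that copy. -/
theorem connectedComponent_homeomorph_core_of_mem [∀ n, CompactSpace (Y n)] {n m : ℕ} {i : T → Y n}
    (hi : IsOpenEmbedding i) (hi' : IsClosed (range i)) {t : T} {g : Y m → Y n}
    (hg : IsOpenEmbedding g) (ht : i t ∈ g '' S.core m) :
    Nonempty (connectedComponent t ≃ₜ S.core m) := by
  refine S.nonempty_connectedComponent_homeomorph_core hi hi' hg ?_
  have hpre : IsPreconnected (i '' connectedComponent t) :=
    isPreconnected_connectedComponent.image _ hi.continuous.continuousOn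
  have htD : i t ∈ i '' connectedComponent t := mem_image_of_mem _ mem_connectedComponent
  obtain ⟨y, hy, hyt⟩ := ht
  have hsub : i '' connectedComponent t ⊆ range g :=
    hpre.subset_isClopen ⟨(isCompact_range hg.continuous).isClosed, hg.isOpen_range⟩
      ⟨_, htD, y, hyt⟩
  have hpre' := hpre.preimage_of_isOpenMap hg.injective hg.isOpenMap hsub
  intro z hz
  obtain ⟨z, rfl⟩ := hsub hz
  refine mem_image_of_mem _ ?_
  by_contra hzc
  obtain ⟨k, z', rfl⟩ := S.exists_incl_eq hzc
  obtain ⟨y', rfl⟩ := hpre'.subset_isClopen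
    ⟨S.isClosed_range_incl m k, (S.isOpenEmbedding_incl m k).isOpen_range⟩
    ⟨_, hz, mem_range_self z'⟩ (show g y ∈ _ from hyt ▸ htD)
  exact S.incl_notMem_core y' hy

/-- In a clopen subspace that lies in a copy of `Y l`, all nondegenerate components are homeomorphic
to cores of levels at least `l`. -/
theorem connectedComponent_homeomorph_core_of_range_subset [∀ n, CompactSpace (Y n)] {n l : ℕ}
    {i : T → Y n} (hi : IsOpenEmbedding i) (hi' : IsClosed (range i)) {t : T}
    (ht : (connectedComponent t).Nontrivial) {g : Y l → Y n} (hg : IsOpenEmbedding g)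
    (hig : range i ⊆ range g) :
    ∃ m ≥ l, Nonempty (connectedComponent t ≃ₜ S.core m) := by
  have hsub : i '' connectedComponent t ⊆ range g := (image_subset_range _ _).trans hig
  have hpre : IsPreconnected (i '' connectedComponent t) :=
    isPreconnected_connectedComponent.image _ hi.continuous.continuousOn
  obtain ⟨m, hm, g', hg', hD⟩ := S.exists_subset_image_core
    (hpre.preimage_of_isOpenMap hg.injective hg.isOpenMap hsub)
    (nontrivial_of_image g _ (by
      rw [image_preimage_eq_of_subset hsub]
      exact Set.Nontrivial.image ht hi.injective))
  refine ⟨m, hm, S.nonempty_connectedComponent_homeomorph_core hi hi' (hg.comp hg') ?_⟩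
  intro z hz
  obtain ⟨z, rfl⟩ := hsub hz
  rw [image_comp]
  exact mem_image_of_mem _ (hD hz)

/-- If the cores are pairwise non-homeomorphic, no type of clopen sets converges to every point:
such a clopen set has a component homeomorphic to the core of some level, and no clopen set inside
a cell of a higher level has such a component. -/
theorem not_hasConstantUniversalSequence [∀ n, CompactSpace (Y n)]
    (hS : ∀ m n, m ≠ n → IsEmpty (S.core m ≃ₜ S.core n)) :
    ¬ HasConstantUniversalSequence (Y 0) := by
  rintro ⟨T, _, hT⟩
  -- The constant address `0, 0, …` serves as an example of a point in cells of all levels.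
  obtain ⟨x, hx⟩ : (⋂ n, range (S.cellMap n 0)).Nonempty := by
    have (n : ℕ) : Nonempty (Y n) := S.nonempty n
    exact IsCompact.nonempty_iInter_of_sequence_nonempty_isCompact_isClosed _
      (fun n => S.range_cellMap_anti n.le_succ 0) (fun n => range_nonempty _)
      (S.isClosed_range_cellMap 0 0).isCompact fun n => S.isClosed_range_cellMap n 0
  rw [mem_iInter] at hx
  obtain ⟨B, hne, hclopen, -, hconv, he⟩ := hT x
  have e : ∀ n, B n ≃ₜ T := fun n => (he n).some
  have hval : ∀ n, IsOpenEmbedding fun t => ((e n).symm t : Y 0) := fun n =>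
    (hclopen n).isOpen.isOpenEmbedding_subtypeVal.comp (e n).symm.isOpenEmbedding
  have hrange : ∀ n, range (fun t => ((e n).symm t : Y 0)) = B n := fun n => by
    rw [range_comp' Subtype.val, (e n).symm.surjective.range_eq, image_univ, Subtype.range_val]
  have hclosed : ∀ n, IsClosed (range fun t => ((e n).symm t : Y 0)) := fun n => by
    rw [hrange]
    exact (hclopen n).isClosed
  obtain ⟨y, hy⟩ := hne 0
  obtain ⟨w, hw, -, -⟩ := S.exists_cells_setsConvergeTo y
  obtain ⟨m, hm⟩ := hw _ ((hclopen 0).isOpen.mem_nhds hy)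
  obtain ⟨c, hc⟩ := (S.isConnected_core (m + 1)).nonempty
  have hcB : S.cellMap (m + 1) (w m) c ∈ B 0 := hm m le_rfl (mem_range_self c)
  obtain ⟨a⟩ := S.connectedComponent_homeomorph_core_of_mem (t := e 0 ⟨_, hcB⟩) (hval 0)
    (hclosed 0) (S.isOpenEmbedding_cellMap (m + 1) (w m)) (by
      rw [Homeomorph.symm_apply_apply]
      exact mem_image_of_mem _ hc)
  have hnt : (connectedComponent (e 0 ⟨_, hcB⟩)).Nontrivial := by
    rw [← nontrivial_coe_sort, a.toEquiv.nontrivial_congr, nontrivial_coe_sort]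
    exact S.nontrivial_core (m + 1)
  obtain ⟨N, hN⟩ := hconv _ ((S.isOpenEmbedding_cellMap (m + 2) 0).isOpen_range.mem_nhds
    (hx (m + 2)))
  obtain ⟨l, hl, ⟨b⟩⟩ := S.connectedComponent_homeomorph_core_of_range_subset (hval N) (hclosed N)
    hnt (S.isOpenEmbedding_cellMap (m + 2) 0) ((hrange N).trans_subset (hN N le_rfl))
  exact (hS (m + 1) l (by omega)).false (a.symm.trans b)

end CellTower

/-! ### Affine maps between cubes -/

namespace Cube

theorem eq_of_center_radius {C D : Cube} (h : C.center = D.center) (h' : C.radius = D.radius) :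
    C = D := by
  cases C
  cases D
  subst h h'
  rfl

theorem affineMap_apply (C : Cube) (x : Space3) (i : Fin 3) :
    C.affineMap x i = 2 * C.radius * (x i - 1 / 2) + C.center i := rfl

theorem dist_affineMap (C : Cube) (x y : Space3) :
    dist (C.affineMap x) (C.affineMap y) = 2 * C.radius * dist x y := by
  rw [affineMap, affineMap, dist_add_right, dist_smul₀, dist_sub_right,
    Real.norm_of_nonneg (mul_pos two_pos C.radius_pos).le]

theorem affineMap_injective (C : Cube) : Function.Injective C.affineMap := fun x y h => by
  have h1 := C.dist_affineMap x y
  rw [h, dist_self, eq_comm, mul_eq_zero] at h1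
  exact dist_eq_zero.1 (h1.resolve_left (mul_pos two_pos C.radius_pos).ne')

theorem continuous_affineMap (C : Cube) : Continuous C.affineMap := by
  unfold affineMap
  fun_prop

theorem affineMap_relCube (C Q : Cube) (x : Space3) :
    (C.relCube Q).affineMap x = C.affineMap (Q.affineMap x) := by
  funext i
  simp only [affineMap_apply, relCube]
  ring

theorem relativize_relCube (C Q : Cube) (A : Set Space3) :
    (C.relCube Q).relativize A = C.relativize (Q.relativize A) := by
  simp only [relativize, image_image, affineMap_relCube]

theorem relCube_assoc (A B C : Cube) : (A.relCube B).relCube C = A.relCube (B.relCube C) := by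
  refine eq_of_center_radius (affineMap_relCube A B C.center) ?_
  simp only [relCube]
  ring

theorem unit_affineMap (x : Space3) : unit.affineMap x = x := by
  funext i
  simp only [affineMap_apply, unit]
  ring

theorem unit_relativize (A : Set Space3) : unit.relativize A = A := by
  simp only [relativize, unit_affineMap, image_id']

theorem unit_relCube (C : Cube) : unit.relCube C = C := by
  refine eq_of_center_radius (unit_affineMap _) ?_
  simp only [relCube, unit]
  ring

theorem relCube_unit (C : Cube) : C.relCube unit = C := by
  refine eq_of_center_radius ?_ ?_
  · funext i
    simp only [relCube, affineMap_apply, unit]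
    ring
  · simp only [relCube, unit]
    ring

theorem relativize_unit (C : Cube) : C.relativize unit.toSet = C.toSet := by
  rw [← toSet_relCube, relCube_unit]

theorem relativize_subset (C : Cube) {A : Set Space3} (h : A ⊆ unit.toSet) :
    C.relativize A ⊆ C.toSet := by
  rw [← relativize_unit C]
  exact image_mono h

theorem mem_toSet {C : Cube} {y : Space3} :
    y ∈ C.toSet ↔ ∀ i, |y i - C.center i| ≤ C.radius := by
  rw [toSet, Metric.mem_closedBall, dist_pi_le_iff C.radius_pos.le]
  rfl

end Cube

/-! ### Position of the cubes of a block -/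

section Block

variable {d : ℕ → Space3}

theorem blockCube_radius (k : ℕ) : (blockCube d k).radius = (1 / 4) ^ (k + 1) / 2 := by
  simp only [blockCube, hangingCube]
  rw [pow_succ, pow_mul]
  norm_num
  ring

theorem blockCube_center (k : ℕ) (i : Fin 3) :
    (blockCube d k).center i = d k i + (![0, 0, (1 / 4) ^ (k + 1)] : Space3) i := by
  simp only [blockCube, hangingCube, pow_mul]
  norm_num

theorem blockCube_height {k : ℕ} (hd : d k ∈ baseSquare) {y : Space3}
    (hy : y ∈ (blockCube d k).toSet) :
    (1 / 4) ^ (k + 1) / 2 ≤ y 2 - 1 / 2 ∧ y 2 - 1 / 2 ≤ 3 / 2 * (1 / 4) ^ (k + 1) := by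
  have h := Cube.mem_toSet.1 hy 2
  rw [blockCube_radius, blockCube_center, hd.2.2, abs_le] at h
  simp only [Matrix.cons_val] at h
  constructor <;> linarith

theorem quarter_pow_le_quarter (k : ℕ) : (1 / 4 : ℝ) ^ (k + 1) ≤ 1 / 4 := by
  rw [pow_succ]
  exact mul_le_of_le_one_left (by norm_num) (pow_le_one₀ (by norm_num) (by norm_num))

theorem blockCube_subset_unit {k : ℕ} (hd : d k ∈ baseSquare) :
    (blockCube d k).toSet ⊆ Cube.unit.toSet := by
  intro y hy
  have h := Cube.mem_toSet.1 hy
  have hq := quarter_pow_le_quarter k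
  have h5 := blockCube_height hd hy
  obtain ⟨⟨h1, h2⟩, ⟨h3, h4⟩, -⟩ := hd
  have hpos : (0 : ℝ) < (1 / 4) ^ (k + 1) := by positivity
  simp only [blockCube_radius, blockCube_center, abs_le] at h
  rw [Cube.toSet_unit]
  have h0 := h 0
  have h1' := h 1
  simp only [Matrix.cons_val] at h0 h1'
  refine ⟨fun i => ?_, fun i => ?_⟩ <;> fin_cases i <;>
    simp only [Fin.zero_eta, Fin.mk_one, Fin.reduceFinMk, Pi.zero_apply, Pi.one_apply] <;> linarith

theorem dist_le_of_mem_blockCube {k : ℕ} {y : Space3} (hy : y ∈ (blockCube d k).toSet) :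
    dist y (d k) ≤ 2 * (1 / 4) ^ (k + 1) := by
  have hpos : (0 : ℝ) < (1 / 4) ^ (k + 1) := by positivity
  have h := Cube.mem_toSet.1 hy
  simp only [blockCube_radius, blockCube_center, abs_le] at h
  refine (dist_pi_le_iff (by positivity)).2 fun i => ?_
  rw [Real.dist_eq, abs_le]
  have hi := h i
  fin_cases i <;> simp at hi ⊢ <;> constructor <;> linarith

theorem quarter_pow_mul_le {j k : ℕ} (h : j < k) :
    4 * (1 / 4 : ℝ) ^ (k + 1) ≤ (1 / 4) ^ (j + 1) := by
  have h1 : (1 / 4 : ℝ) ^ (k + 1) ≤ (1 / 4) ^ (j + 2) :=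
    pow_le_pow_of_le_one (by norm_num) (by norm_num) (by omega)
  rw [pow_succ _ (j + 1)] at h1
  linarith

theorem disjoint_blockCube (hd : ∀ k, d k ∈ baseSquare) :
    Pairwise fun j k => Disjoint (blockCube d j).toSet (blockCube d k).toSet := by
  intro j k hjk
  wlog h : j < k generalizing j k
  · exact (this hjk.symm (by omega)).symm
  refine disjoint_left.2 fun y hj hk => ?_
  have h1 := blockCube_height (hd j) hj
  have h2 := blockCube_height (hd k) hk
  have h3 := quarter_pow_mul_le h
  have hpos : (0 : ℝ) < (1 / 4) ^ (k + 1) := by positivity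
  linarith [h1.1, h2.2]

theorem notMem_baseSquare_of_mem_blockCube {k : ℕ} (hd : d k ∈ baseSquare) {y : Space3}
    (hy : y ∈ (blockCube d k).toSet) : y ∉ baseSquare := fun h => by
  have h1 := (blockCube_height hd hy).1
  have hpos : (0 : ℝ) < (1 / 4) ^ (k + 1) := by positivity
  rw [h.2.2] at h1
  linarith

/-- The cubes of a block converge to the continuum. -/
theorem eventually_blockCube_subset {E U : Set Space3} (hE : IsCompact E) (hd : ∀ k, d k ∈ E)
    (hU : IsOpen U) (hEU : E ⊆ U) : ∀ᶠ k in atTop, (blockCube d k).toSet ⊆ U := by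
  obtain ⟨ε, hε, hεU⟩ := hE.exists_thickening_subset_open hU hEU
  have hlim : Tendsto (fun k : ℕ => 2 * (1 / 4 : ℝ) ^ (k + 1)) atTop (𝓝 (2 * 0)) :=
    ((tendsto_pow_atTop_nhds_zero_of_lt_one (by norm_num) (by norm_num)).comp
      (tendsto_add_atTop_nat 1)).const_mul 2
  rw [mul_zero] at hlim
  filter_upwards [hlim.eventually_lt_const hε] with k hk y hy
  exact hεU (Metric.mem_thickening_iff.2
    ⟨d k, hd k, (dist_le_of_mem_blockCube hy).trans_lt hk⟩)

theorem baseSquare_subset_unit : baseSquare ⊆ Cube.unit.toSet := by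
  rintro y ⟨⟨h1, h2⟩, ⟨h3, h4⟩, h5⟩
  rw [Cube.toSet_unit]
  refine ⟨fun i => ?_, fun i => ?_⟩ <;> fin_cases i <;>
    simp only [Fin.zero_eta, Fin.mk_one, Fin.reduceFinMk, Pi.zero_apply, Pi.one_apply] <;> linarith

/-- If `d` enumerates a dense subset of a nondegenerate connected set, then infinitely many cubes
of the block lie in any given neighbourhood of a point of that set. -/
theorem frequently_blockCube_subset {E U : Set Space3} (hE : IsConnected E)
    (hE' : E.Nontrivial) (hd : E ⊆ closure (range d)) {x : Space3} (hx : x ∈ E) (hU : U ∈ 𝓝 x) :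
    ∃ᶠ k in atTop, (blockCube d k).toSet ⊆ U := by
  obtain ⟨ε, hε, hεU⟩ := Metric.mem_nhds_iff.1 hU
  have hlim : Tendsto (fun k : ℕ => 2 * (1 / 4 : ℝ) ^ (k + 1)) atTop (𝓝 (2 * 0)) :=
    ((tendsto_pow_atTop_nhds_zero_of_lt_one (by norm_num) (by norm_num)).comp
      (tendsto_add_atTop_nat 1)).const_mul 2
  rw [mul_zero] at hlim
  have hfreq : ∃ᶠ k in atTop, d k ∈ Metric.ball x (ε / 2) := by
    refine frequently_atTop.2 fun N => ?_
    have hacc := hE.isPreconnected.preperfect_of_nontrivial hE' x hx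
    have hinf := Set.Infinite.of_accPt (hacc.nhds_inter (Metric.ball_mem_nhds x (half_pos hε)))
    obtain ⟨y, hy, hyN⟩ := hinf.exists_notMem_finset ((Finset.range N).image d)
    have hopen : IsOpen (Metric.ball x (ε / 2) \ ((Finset.range N).image d : Set Space3)) :=
      Metric.isOpen_ball.sdiff (Finset.finite_toSet _).isClosed
    obtain ⟨_, ⟨h1, h2⟩, k, rfl⟩ := mem_closure_iff.1 (hd hy.2) _ hopen ⟨hy.1, hyN⟩
    refine ⟨k, ?_, h1⟩
    by_contra hk
    exact h2 (Finset.mem_coe.2 (Finset.mem_image_of_mem d (Finset.mem_range.2 (not_le.1 hk))))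
  refine (hfreq.and_eventually (hlim.eventually_lt_const (half_pos hε))).mono ?_
  rintro k ⟨h1, h2⟩ y hy
  refine hεU (Metric.mem_ball.2 ((dist_triangle y (d k) x).trans_lt ?_))
  linarith [dist_le_of_mem_blockCube hy, Metric.mem_ball.1 h1]

end Block

/-! ### Self-similarity of the limit space -/

/-- The cube of the word `k` followed by `g`, from the outermost letter inwards. -/
theorem wordCube_cons (d : ℕ → ℕ → Space3) (n k : ℕ) (g : Fin n → ℕ) :
    wordCube (fun n _ => d n) (n + 1) (Fin.cons k g) =
      (blockCube (d 0) k).relCube (wordCube (fun n _ => d (n + 1)) n g) := by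
  induction n with
  | zero =>
    simp only [wordCube, Cube.unit_relCube, Cube.relCube_unit]
    rfl
  | succ n ih =>
    have hinit : Fin.init (Fin.cons k g : Fin (n + 2) → ℕ) = Fin.cons k (Fin.init g) := by
      funext i
      exact Fin.cases rfl (fun _ => rfl) i
    rw [wordCube, hinit, ih, Cube.relCube_assoc]
    rfl

theorem iUnion_fin_succ {α : Type*} (n : ℕ) (G : (Fin (n + 1) → ℕ) → Set α) :
    ⋃ f, G f = ⋃ (k : ℕ) (g : Fin n → ℕ), G (Fin.cons k g) := by
  ext x
  simp only [mem_iUnion, Fin.exists_fin_succ_pi]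

variable {E : ℕ → Set Space3} {d : ℕ → ℕ → Space3}

theorem wordCube_subset_unit (hd : ∀ n k, d n k ∈ baseSquare) (n : ℕ) (f : Fin n → ℕ) :
    (wordCube (fun n _ => d n) n f).toSet ⊆ Cube.unit.toSet := by
  induction n with
  | zero => rfl
  | succ n ih =>
    rw [wordCube, Cube.toSet_relCube]
    exact (Cube.relativize_subset _ (blockCube_subset_unit (hd _ _))).trans (ih _)

theorem block_subset_unit {F : Set Space3} {p : ℕ → Space3} (hF : F ⊆ baseSquare)
    (hp : ∀ k, p k ∈ baseSquare) : block F p ⊆ Cube.unit.toSet :=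
  union_subset (hF.trans baseSquare_subset_unit)
    (iUnion_subset fun k => blockCube_subset_unit (hp k))

theorem stage_subset_unit (hE : ∀ n, E n ⊆ baseSquare) (hd : ∀ n k, d n k ∈ baseSquare) (n : ℕ) :
    stage (fun n _ => E n) (fun n _ => d n) n ⊆ Cube.unit.toSet := by
  induction n with
  | zero => rfl
  | succ n ih =>
    exact union_subset (sdiff_subset.trans ih) (iUnion_subset fun f =>
      (Cube.relativize_subset _ (block_subset_unit (hE n) (hd n))).trans
        (wordCube_subset_unit hd n f))

/-- Each stage consists of the first continuum and of copies of the previous stage of the shifted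
construction. -/
theorem stage_succ_eq (hE : ∀ n, E n ⊆ baseSquare) (hd : ∀ n k, d n k ∈ baseSquare) (n : ℕ) :
    stage (fun n _ => E n) (fun n _ => d n) (n + 1) = E 0 ∪ ⋃ k, (blockCube (d 0) k).relativize
      (stage (fun n _ => E (n + 1)) (fun n _ => d (n + 1)) n) := by
  induction n with
  | zero =>
    have : Nonempty (Fin 0 → ℕ) := ⟨Fin.elim0⟩
    simp only [stage, wordCube, iUnion_const, sdiff_self, empty_union, Cube.unit_relativize,
      Cube.relativize_unit, block]
  | succ n ih =>
    rw [stage, ih, stage, iUnion_fin_succ, iUnion_fin_succ]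
    simp only [wordCube_cons, Cube.toSet_relCube, Cube.relativize_relCube]
    have hA := stage_subset_unit (E := fun n => E (n + 1)) (d := fun n => d (n + 1))
      (fun n => hE _) (fun n => hd _) n
    have hB : (⋃ g : Fin n → ℕ, (wordCube (fun n _ => d (n + 1)) n g).toSet) ⊆
        Cube.unit.toSet :=
      iUnion_subset fun g => wordCube_subset_unit (d := fun n => d (n + 1)) (fun n => hd _) n g
    simp only [Cube.relativize, ← image_iUnion, image_union]
    generalize stage (fun n _ => E (n + 1)) (fun n _ => d (n + 1)) n = A at hA
    generalize (⋃ g : Fin n → ℕ, (wordCube (fun n _ => d (n + 1)) n g).toSet) = B at hB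
    have h1 : E 0 \ ⋃ k, (blockCube (d 0) k).affineMap '' B = E 0 := by
      refine sdiff_eq_left.2 (disjoint_left.2 fun y hy hyB => ?_)
      obtain ⟨k, hk⟩ := mem_iUnion.1 hyB
      exact notMem_baseSquare_of_mem_blockCube (hd 0 k) (Cube.relativize_subset _ hB hk) (hE 0 hy)
    have h2 : (⋃ k, (blockCube (d 0) k).affineMap '' A) \ ⋃ k, (blockCube (d 0) k).affineMap '' B =
        ⋃ k, (blockCube (d 0) k).affineMap '' (A \ B) := by
      ext y
      constructor
      · rintro ⟨hy, hyB⟩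
        obtain ⟨k, a, ha, rfl⟩ := mem_iUnion.1 hy
        exact mem_iUnion.2 ⟨k, a, ⟨ha, fun hb => hyB (mem_iUnion.2 ⟨k, a, hb, rfl⟩)⟩, rfl⟩
      · intro hy
        obtain ⟨k, a, ⟨ha, hb⟩, rfl⟩ := mem_iUnion.1 hy
        refine ⟨mem_iUnion.2 ⟨k, a, ha, rfl⟩, fun hyB => ?_⟩
        obtain ⟨j, b, hbB, hab⟩ := mem_iUnion.1 hyB
        have hjk : j = k := by
          by_contra hjk
          exact disjoint_left.1 (disjoint_blockCube (hd 0) hjk)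
            (Cube.relativize_subset _ hB ⟨b, hbB, hab⟩) (Cube.relativize_subset _ hA ⟨a, ha, rfl⟩)
        subst hjk
        exact hb (Cube.affineMap_injective _ hab ▸ hbB)
    rw [union_sdiff_distrib, h1, h2, union_assoc, iUnion_union_distrib]

theorem levelSpace_subset_unit : levelSpace E d ⊆ Cube.unit.toSet := iInter_subset _ 0

/-- The limit space consists of the first continuum and of copies of the limit space of the
shifted construction. -/
theorem levelSpace_eq (hE : ∀ n, E n ⊆ baseSquare) (hd : ∀ n k, d n k ∈ baseSquare) :
    levelSpace E d = E 0 ∪ ⋃ k, (blockCube (d 0) k).relativize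
      (levelSpace (fun n => E (n + 1)) fun n => d (n + 1)) := by
  have hstage := stage_succ_eq hE hd
  have hA := stage_subset_unit (E := fun n => E (n + 1)) (d := fun n => d (n + 1))
    (fun n => hE _) fun n => hd _
  ext y
  constructor
  · intro hy
    have hy' : ∀ n, y ∈ E 0 ∪ ⋃ k, (blockCube (d 0) k).relativize
        (stage (fun n _ => E (n + 1)) (fun n _ => d (n + 1)) n) := fun n =>
      hstage n ▸ mem_iInter.1 hy (n + 1)
    by_cases hyE : y ∈ E 0
    · exact .inl hyE
    have hy'' := fun n => mem_iUnion.1 ((hy' n).resolve_left hyE)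
    obtain ⟨k, a, ha, rfl⟩ := hy'' 0
    refine .inr (mem_iUnion.2 ⟨k, a, mem_iInter.2 fun n => ?_, rfl⟩)
    obtain ⟨j, b, hb, hab⟩ := hy'' n
    have hjk : j = k := by
      by_contra hjk
      exact disjoint_left.1 (disjoint_blockCube (hd 0) hjk)
        (Cube.relativize_subset _ (hA n) ⟨b, hb, hab⟩)
        (Cube.relativize_subset _ (hA 0) ⟨a, ha, rfl⟩)
    subst hjk
    exact Cube.affineMap_injective _ hab ▸ hb
  · intro hy
    refine mem_iInter.2 fun n => ?_
    rcases n with _ | n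
    · rcases hy with hy | hy
      · exact baseSquare_subset_unit (hE 0 hy)
      · obtain ⟨k, hk⟩ := mem_iUnion.1 hy
        exact blockCube_subset_unit (hd 0 k)
          (Cube.relativize_subset _ levelSpace_subset_unit hk)
    · rw [hstage n]
      exact union_subset_union_right _ (iUnion_mono fun k => image_mono (iInter_subset _ n)) hy

/-- A compact set together with a sequence of compact sets that is eventually contained in each of
its neighbourhoods is compact. -/
theorem IsCompact.union_iUnion_of_eventually_subset {X : Type*} [TopologicalSpace X] {K : Set X}
    {A : ℕ → Set X} (hK : IsCompact K) (hA : ∀ k, IsCompact (A k))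
    (h : ∀ U, IsOpen U → K ⊆ U → ∀ᶠ k in atTop, A k ⊆ U) : IsCompact (K ∪ ⋃ k, A k) := by
  classical
  refine isCompact_of_finite_subcover fun {ι} U hU hcover => ?_
  obtain ⟨s, hs⟩ := hK.elim_finite_subcover U hU (subset_union_left.trans hcover)
  obtain ⟨N, hN⟩ := eventually_atTop.1 (h _ (isOpen_biUnion fun i _ => hU i) hs)
  obtain ⟨t, ht⟩ := ((Finset.range N).isCompact_biUnion fun k _ => hA k).elim_finite_subcover U hU
    ((iUnion₂_subset fun k _ => subset_iUnion A k).trans (subset_union_right.trans hcover))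
  refine ⟨s ∪ t, ?_⟩
  rw [Finset.set_biUnion_union]
  refine union_subset (hs.trans subset_union_left) (iUnion_subset fun k => ?_)
  rcases lt_or_ge k N with hk | hk
  · exact ((subset_biUnion_of_mem (u := A) (Finset.mem_coe.2 (Finset.mem_range.2 hk))).trans
      ht).trans subset_union_right
  · exact (hN k hk).trans subset_union_left

theorem isCompact_stage (hE : ∀ n, E n ⊆ baseSquare) (hEc : ∀ n, IsCompact (E n))
    (hd : ∀ n k, d n k ∈ E n) (n : ℕ) :
    IsCompact (stage (fun n _ => E n) (fun n _ => d n) n) := by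
  induction n generalizing E d with
  | zero => exact isCompact_closedBall _ _
  | succ n ih =>
    rw [stage_succ_eq hE fun n k => hE n (hd n k)]
    refine (hEc 0).union_iUnion_of_eventually_subset (fun k => ?_) fun U hU hEU => ?_
    · exact (ih (E := fun n => E (n + 1)) (d := fun n => d (n + 1)) (fun n => hE _) (fun n => hEc _)
        fun n => hd _).image (Cube.continuous_affineMap _)
    · filter_upwards [eventually_blockCube_subset (hEc 0) (hd 0) hU hEU] with k hk
      refine (Cube.relativize_subset _ ?_).trans hk
      exact stage_subset_unit (E := fun n => E (n + 1)) (d := fun n => d (n + 1)) (fun n => hE _)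
        (fun n k => hE _ (hd _ k)) n

theorem isCompact_levelSpace (hE : ∀ n, E n ⊆ baseSquare) (hEc : ∀ n, IsCompact (E n))
    (hd : ∀ n k, d n k ∈ E n) : IsCompact (levelSpace E d) :=
  (isCompact_stage hE hEc hd 0).of_isClosed_subset
    (isClosed_iInter fun n => (isCompact_stage hE hEc hd n).isClosed) (iInter_subset _ 0)

/-! ### The cell tower of the construction -/

/-- The limit space of the construction that starts with the continuum `E n`. -/
def levelTail (E : ℕ → Set Space3) (d : ℕ → ℕ → Space3) (n : ℕ) : Set Space3 :=
  levelSpace (fun i => E (i + n)) fun i => d (i + n)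

theorem levelTail_eq (hE : ∀ n, E n ⊆ baseSquare) (hd : ∀ n k, d n k ∈ baseSquare) (n : ℕ) :
    levelTail E d n =
      E n ∪ ⋃ k, (blockCube (d n) k).relativize (levelTail E d (n + 1)) := by
  have h := levelSpace_eq (E := fun i => E (i + n)) (d := fun i => d (i + n)) (fun i => hE _)
    fun i => hd _
  simp only [Nat.zero_add, Nat.add_right_comm _ 1 n] at h
  exact h

/-- The spaces `levelTail E d n` with the continua as cores. -/
noncomputable def levelTower (hEc : ∀ n, IsCompact (E n)) (hEconn : ∀ n, IsConnected (E n))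
    (hEnt : ∀ n, (E n).Nontrivial) (hE : ∀ n, E n ⊆ baseSquare) (hd : ∀ n k, d n k ∈ E n)
    (hdense : ∀ n, E n ⊆ closure (range (d n))) : CellTower fun n => levelTail E d n :=
  have hd' : ∀ n k, d n k ∈ baseSquare := fun n k => hE n (hd n k)
  have heq := levelTail_eq hE hd'
  have hcore : ∀ n, E n ⊆ levelTail E d n := fun n => heq n ▸ subset_union_left
  have hsub : ∀ n k, (blockCube (d n) k).relativize (levelTail E d (n + 1)) ⊆ levelTail E d n :=
    fun n k => by
      rw [heq n]
      exact (subset_iUnion (fun k => (blockCube (d n) k).relativize (levelTail E d (n + 1)))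
        k).trans subset_union_right
  let incl : ∀ n, ℕ → levelTail E d (n + 1) → levelTail E d n := fun n k y =>
    ⟨(blockCube (d n) k).affineMap y, hsub n k ⟨y, y.2, rfl⟩⟩
  have hincl : ∀ n k y, (incl n k y : Space3) ∈ (blockCube (d n) k).toSet := fun n k y =>
    Cube.relativize_subset _ levelSpace_subset_unit ⟨y, y.2, rfl⟩
  have hcases : ∀ n (y : levelTail E d n), (y : Space3) ∈ E n ∨ ∃ k, y ∈ range (incl n k) := by
    rintro n ⟨y, hy⟩
    have hy' := hy
    rw [heq n] at hy'
    refine hy'.imp id fun h => ?_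
    obtain ⟨k, a, ha, rfl⟩ := mem_iUnion.1 h
    exact ⟨k, ⟨a, ha⟩, rfl⟩
  { core := fun n => Subtype.val ⁻¹' E n
    incl := incl
    isConnected_core := fun n => by
      obtain ⟨x, hx⟩ := (hEconn n).nonempty
      refine ⟨⟨⟨x, hcore n hx⟩, hx⟩, IsInducing.subtypeVal.isPreconnected_image.1 ?_⟩
      rw [Subtype.image_preimage_coe, inter_eq_right.2 (hcore n)]
      exact (hEconn n).isPreconnected
    nontrivial_core := fun n => by
      obtain ⟨x, hx, y, hy, hxy⟩ := hEnt n
      exact ⟨⟨x, hcore n hx⟩, hx, ⟨y, hcore n hy⟩, hy, fun h => hxy (congrArg Subtype.val h)⟩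
    isOpenEmbedding_incl := fun n k => by
      have : CompactSpace (levelTail E d (n + 1)) := isCompact_iff_compactSpace.1
        (isCompact_levelSpace (fun i => hE _) (fun i => hEc _) fun i => hd _)
      have hcont : Continuous (incl n k) :=
        ((Cube.continuous_affineMap _).comp continuous_subtype_val).subtype_mk _
      have hinj : Function.Injective (incl n k) := fun y z h =>
        Subtype.ext (Cube.affineMap_injective _ (congrArg Subtype.val h))
      refine ⟨(hcont.isClosedEmbedding hinj).isEmbedding, ?_⟩
      -- The copy is cut out by an open horizontal slab that meets no other cube of the block.
      -- In units of `(1 / 4) ^ (k + 1)`, the heights over the base square lie in `[1/2, 3/2]` for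
      -- this cube, below `3/8` for the later cubes and above `2` for the earlier ones.
      have hslab : range (incl n k) = {y : levelTail E d n |
          9 / 20 * (1 / 4) ^ (k + 1) < (y : Space3) 2 - 1 / 2 ∧
            (y : Space3) 2 - 1 / 2 < 8 / 5 * (1 / 4) ^ (k + 1)} := by
        have hpos : (0 : ℝ) < (1 / 4) ^ (k + 1) := by positivity
        ext y
        constructor
        · rintro ⟨z, rfl⟩
          have h := blockCube_height (hd' n k) (hincl n k z)
          exact ⟨by linarith [h.1], by linarith [h.2]⟩
        · rintro ⟨h1, h2⟩
          rcases hcases n y with hy | ⟨j, z, rfl⟩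
          · have := (hE n hy).2.2
            linarith
          have h := blockCube_height (hd' n j) (hincl n j z)
          rcases lt_trichotomy j k with hjk | rfl | hjk
          · linarith [quarter_pow_mul_le hjk]
          · exact mem_range_self z
          · linarith [quarter_pow_mul_le hjk]
      rw [hslab]
      have hc : Continuous fun y : levelTail E d n => (y : Space3) 2 - 1 / 2 :=
        ((continuous_apply 2).comp continuous_subtype_val).sub continuous_const
      exact (isOpen_lt continuous_const hc).inter (isOpen_lt hc continuous_const)
    disjoint_range_incl := fun n j k hjk => disjoint_left.2 <| by
      rintro _ ⟨y, rfl⟩ ⟨z, hz⟩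
      exact disjoint_left.1 (disjoint_blockCube (hd' n) hjk) (hincl n j y) (hz ▸ hincl n k z)
    compl_core := fun n => by
      ext y
      refine ⟨fun hy => mem_iUnion.2 ((hcases n y).resolve_left hy), fun hy => ?_⟩
      obtain ⟨k, z, rfl⟩ := mem_iUnion.1 hy
      exact fun h => notMem_baseSquare_of_mem_blockCube (hd' n k) (hincl n k z) (hE n h)
    frequently_range_incl_subset := fun n y hy U hU => by
      obtain ⟨V, hV, hVU⟩ := mem_nhds_subtype _ _ _ |>.1 hU
      refine (frequently_blockCube_subset (hEconn n) (hEnt n) (hdense n) hy hV).mono ?_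
      rintro k hk _ ⟨z, rfl⟩
      exact hVU (hk (hincl n k z))
    dist_incl_le := fun n k x y => by
      change dist (Cube.affineMap _ _) (Cube.affineMap _ _) ≤ dist (x : Space3) y / 4
      rw [Cube.dist_affineMap, blockCube_radius]
      have := mul_le_mul_of_nonneg_right (quarter_pow_le_quarter k)
        (dist_nonneg (x := (x : Space3)) (y := y))
      linarith
    dist_le_one := fun n x y => by
      have h := fun z : levelTail E d n => (levelSpace_subset_unit z.2 : (z : Space3) ∈ _)
      simp only [Cube.toSet_unit] at h
      refine (dist_pi_le_iff zero_le_one).2 fun i => ?_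
      rw [Real.dist_eq, abs_le]
      have h1 := (h x).1 i
      have h2 := (h x).2 i
      have h3 := (h y).1 i
      have h4 := (h y).2 i
      simp only [Pi.zero_apply, Pi.one_apply] at h1 h2 h3 h4
      constructor <;> linarith }

theorem theorem6p9 (E : ℕ → Set Space3) (d : ℕ → ℕ → Space3)
    (hE_compact : ∀ n, IsCompact (E n))
    (hE_connected : ∀ n, IsConnected (E n))
    (hE_nontrivial : ∀ n, (E n).Nontrivial)
    (hE_planar : ∀ n, E n ⊆ baseSquare)
    (hd_mem : ∀ n k, d n k ∈ E n)
    (hd_dense : ∀ n, E n ⊆ closure (Set.range (d n)))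
    (hE_distinct : ∀ m n, m ≠ n → IsEmpty (E m ≃ₜ E n)) :
    CompactSpace (levelSpace E d) ∧ TopologicalSpace.MetrizableSpace (levelSpace E d) ∧
      ¬ IsReconstructible (levelSpace E d) ∧
      ¬ HasConstantUniversalSequence (levelSpace E d) := by
  have hcompact : ∀ n, CompactSpace (levelTail E d n) := fun n => isCompact_iff_compactSpace.1
    (isCompact_levelSpace (fun i => hE_planar _) (fun i => hE_compact _) fun i => hd_mem _)
  let S := levelTower hE_compact hE_connected hE_nontrivial hE_planar hd_mem hd_dense
  have hcore : ∀ n, Nonempty (S.core n ≃ₜ E n) := fun n => by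
    have hsub : E n ⊆ levelTail E d n := by
      rw [levelTail_eq hE_planar fun n k => hE_planar n (hd_mem n k)]
      exact subset_union_left
    refine ⟨(IsEmbedding.subtypeVal.homeomorphImage _).trans (Homeomorph.setCongr ?_)⟩
    exact (Subtype.image_preimage_coe _ _).trans (inter_eq_right.2 hsub)
  exact ⟨hcompact 0, inferInstance, S.not_isReconstructible,
    S.not_hasConstantUniversalSequence fun m n hmn => ⟨fun e =>
      (hE_distinct m n hmn).false (((hcore m).some.symm.trans e).trans (hcore n).some)⟩⟩
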